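/- Consider $U$ energy-harvesting sensors with battery levels $E_{u,k}\in\mathcal E=\{0,1,\dots,e_{\max}\}$ and a scenario process $\{S_k\}$ that is an irreducible Markov chain on a finite set $\mathcal S$. In slot $k$, sensor $u$ has a packet of utility $V_{u,k}$, a utility observation $Y_{u,k}$ and a channel SNR $\gamma_{u,k}$, which are positive random variables with continuous (absolutely continuous) laws; the triples $(V_{u,k},Y_{u,k},\gamma_{u,k})$ are i.i.d. over $u$ and $k$, and arbitrarily correlated within a triple. Given the scenario $S_k=s$, the energy arrivals $B_{u,k}\in\{0,1\}$ are independent Bernoulli variables of mean $\beta(s)$. A stationary randomized policy of sensor $u$ is a function $\mu_u:\mathcal E\times(0,\infty)\times\mathcal S\to[0,1]$ with $\mu_u(0,\cdot,\cdot)=0$. Given $(E_{u,k},Y_{u,k},S_k)$, sensor $u$ transmits ($Q_{u,k}=1$) with probability $\mu_u(E_{u,k},Y_{u,k},S_k)$, independently of the other sensors, and stays idle ($Q_{u,k}=0$) otherwise. The battery evolves as $E_{u,k+1}=\min\{E_{u,k}-Q_{u,k}+B_{u,k},\,e_{\max}\}$. For a joint policy $\boldsymbol\mu=(\mu_1,\dots,\mu_U)$,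 an initial energy vector $\mathbf e_0$ and an initial scenario $s_0$, let $$R_{\boldsymbol\mu}(\mathbf e_0,s_0)=\sum_{u=1}^U\liminf_{K\to\infty}\frac1K\,\mathbb E\Big[\sum_{k=0}^{K-1}\chi\big(\gamma_{u,k}>\gamma_{\mathrm{th}}(Y_{u,k})\big)\,Q_{u,k}V_{u,k}\prod_{i\ne u}(1-Q_{i,k})\,\Big|\,\mathbf E_0=\mathbf e_0,S_0=s_0,\boldsymbol\mu\Big],$$ where $\chi$ is the indicator function and $\gamma_{\mathrm{th}}$ is a given measurable function. A joint policy is optimal from $(\mathbf e_0,s_0)$ if it maximizes $R_{\boldsymbol\mu}(\mathbf e_0,s_0)$ over all joint stationary randomized policies. Assume that $\chi(\gamma_{u,k}>\gamma_{\mathrm{th}}(Y_{u,k}))V_{u,k}$ is integrable and that $\bar V(y)=\mathbb E[\chi(\gamma_{u,k}>\gamma_{\mathrm{th}}(Y_{u,k}))V_{u,k}\mid Y_{u,k}=y]$ is strictly increasing and continuous on $(0,\infty)$, with $\bar V(0)=0$ and $\lim_{y\to\infty}\bar V(y)=\infty$. Then optimal policies are threshold rules on the utility observation, in the following sense. For every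 joint policy $\boldsymbol\mu$ there are thresholds $y^*_{\mathrm{th},u}(e,s)\in[0,\infty]$, $u\in\{1,\dots,U\}$, $e\in\mathcal E$, $s\in\mathcal S$, such that the threshold policy $$\mu^*_u(e,y,s)=\chi\big(y\ge y^*_{\mathrm{th},u}(e,s)\big),\qquad y>0,$$ is an admissible choice (it never transmits when $e=0$), has the same transmission probabilities, $\mathbb E[\mu^*_u(e,Y,s)]=\mathbb E[\mu_u(e,Y,s)]$ for all $u,e,s$, and satisfies $R_{\boldsymbol\mu}(\mathbf e_0,s_0)\le R_{\boldsymbol\mu^*}(\mathbf e_0,s_0)$ for all $(\mathbf e_0,s_0)$. Moreover, if $\boldsymbol\mu$ is optimal from $(\mathbf e_0,s_0)$, then so is the threshold policy $\boldsymbol\mu^*$, and $\boldsymbol\mu$ itself is this threshold rule wherever its decisions matter: for all $u,e,s$ with $$\liminf_{K\to\infty}\frac1K\sum_{k=0}^{K-1}\mathbb P\big(E_{u,k}=e,\ S_k=s,\ Q_{i,k}=0\ \ \forall i\ne u\,\big|\,\mathbf E_0=\mathbf e_0,S_0=s_0,\boldsymbol\mu\big)>0,$$ one has $\mu_u(e,Y,s)=\chi\big(Y\ge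 y^*_{\mathrm{th},u}(e,s)\big)$ almost surely. -/

import Mathlib

open MeasureTheory ProbabilityTheory Filter
open scoped ENNReal

/-- Realization of `(V, Y, γ)` for one sensor in one slot: packet utility, utility observation
and channel SNR. -/
abbrev Packet : Type := ℝ × ℝ × ℝ

namespace Packet

/-- Packet utility `V`. -/
def utility (x : Packet) : ℝ := x.1

/-- Utility observation `Y`. -/
def obs (x : Packet) : ℝ := x.2.1

/-- Channel SNR `γ`. -/
def snr (x : Packet) : ℝ := x.2.2

theorem measurable_obs : Measurable Packet.obs := measurable_fst.comp measurable_snd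

end Packet

/-- The law of an almost surely positive, continuous (absolutely continuous) random variable. -/
def IsPositiveContinuousLaw (m : Measure ℝ) : Prop :=
  m (Set.Iic 0) = 0 ∧ m ≪ volume

/-- Parameters of the energy-harvesting sensor network with (finite) scenario set `S`. -/
structure Network (S : Type*) where
  /-- joint law of `(V, Y, γ)`; the same for all sensors and slots -/
  packetLaw : Measure Packet
  isProbabilityMeasure_packetLaw : IsProbabilityMeasure packetLaw
  utility_law : IsPositiveContinuousLaw (packetLaw.map Packet.utility)
  obs_law : IsPositiveContinuousLaw (packetLaw.map Packet.obs)
  snr_law : IsPositiveContinuousLaw (packetLaw.map Packet.snr)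
  /-- SNR decoding threshold as a function of the utility observation -/
  snrThreshold : ℝ → ℝ
  measurable_snrThreshold : Measurable snrThreshold
  /-- probability of harvesting one energy quantum in each scenario -/
  harvestRate : S → unitInterval
  /-- `scenarioTrans s s'` is the transition probability from `s` to `s'` -/
  scenarioTrans : S → PMF S
  /-- the scenario chain is irreducible -/
  irreducible : ∀ s s' : S, Relation.ReflTransGen (fun a b => scenarioTrans a b ≠ 0) s s'

attribute [instance] Network.isProbabilityMeasure_packetLaw

/-- The utility of a packet if it survives the channel fading, and `0` otherwise:
`χ(γ > γ_th(Y)) V`. -/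
noncomputable def Network.deliveredUtility {S : Type*} (N : Network S) (x : Packet) : ℝ :=
  if N.snrThreshold x.obs < x.snr then x.utility else 0

/-- `Vbar` is (a version of) `y ↦ 𝔼[χ(γ > γ_th(Y)) V | Y = y]`. -/
def Network.IsExpectedUtility {S : Type*} (N : Network S) (Vbar : ℝ → ℝ) : Prop :=
  Integrable N.deliveredUtility N.packetLaw ∧
    (fun x : Packet => Vbar x.obs) =ᵐ[N.packetLaw]
      N.packetLaw[N.deliveredUtility | MeasurableSpace.comap Packet.obs inferInstance]

/-- The assumption on the expected utility: strictly increasing and continuous on `(0, ∞)`,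
unbounded, and zero at zero. -/
structure IsRegularUtility (Vbar : ℝ → ℝ) : Prop where
  strictMonoOn : StrictMonoOn Vbar (Set.Ioi 0)
  continuousOn : ContinuousOn Vbar (Set.Ioi 0)
  tendsto_atTop : Tendsto Vbar atTop atTop
  map_zero : Vbar 0 = 0

/-- A stationary randomized transmission policy of one sensor with battery capacity `emax`:
`prob e y s` is the probability of transmitting at energy level `e`, utility observation `y` and
scenario `s`. A sensor with an empty battery cannot transmit. -/
structure Policy (emax : ℕ) (S : Type*) where
  prob : Fin (emax + 1) → ℝ → S → unitInterval
  measurable_prob : ∀ e s, Measurable fun y => prob e y s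
  prob_empty : ∀ y s, prob 0 y s = 0

/-- A joint policy of the `U` sensors. -/
abbrev JointPolicy (U emax : ℕ) (S : Type*) : Type _ := Fin U → Policy emax S

/-- What happens at one sensor in one slot: packet, transmit action `Q`, harvested quantum `B`. -/
abbrev LocalSlot : Type := (Packet × Bool) × Bool

namespace LocalSlot

/-- The packet of the slot. -/
def packet (r : LocalSlot) : Packet := r.1.1

/-- The transmit action `Q`. -/
def transmits (r : LocalSlot) : Bool := r.1.2

/-- The energy arrival `B`. -/
def harvests (r : LocalSlot) : Bool := r.2

end LocalSlot

/-- The system state `(E_1, …, E_U, S)` at the beginning of a slot. -/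
abbrev SysState (U emax : ℕ) (S : Type*) : Type _ := (Fin U → Fin (emax + 1)) × S

/-- Full record of a slot: the system state and what happens at every sensor. -/
abbrev Slot (U emax : ℕ) (S : Type*) : Type _ := SysState U emax S × (Fin U → LocalSlot)

section Dynamics

variable {U emax : ℕ} {S : Type*}

/-- The Bernoulli law of the transmit action given the packet, at energy `e` and scenario `s`. -/
noncomputable def Policy.actionKernel (p : Policy emax S) (e : Fin (emax + 1)) (s : S) :
    Kernel Packet Bool where
  toFun x := bernoulliMeasure true false (p.prob e x.obs s)
  measurable' := by
    have h : Measurable fun x : Packet => p.prob e x.obs s :=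
      (p.measurable_prob e s).comp Packet.measurable_obs
    refine Measure.measurable_of_measurable_coe _ fun t ht => ?_
    have h1 : Measurable fun x : Packet => ENNReal.ofReal (p.prob e x.obs s : ℝ) :=
      ENNReal.measurable_ofReal.comp (measurable_subtype_coe.comp h)
    have h2 : Measurable fun x : Packet => ENNReal.ofReal (1 - (p.prob e x.obs s : ℝ)) :=
      ENNReal.measurable_ofReal.comp ((measurable_subtype_coe.comp h).const_sub 1)
    have key : (fun x : Packet => bernoulliMeasure true false (p.prob e x.obs s) t)
        = fun x : Packet => ENNReal.ofReal (p.prob e x.obs s : ℝ) * Measure.dirac true t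
          + ENNReal.ofReal (1 - (p.prob e x.obs s : ℝ)) * Measure.dirac false t := by
      funext x
      have a1 : ((unitInterval.toNNReal (p.prob e x.obs s) : NNReal) : ℝ≥0∞)
          = ENNReal.ofReal (p.prob e x.obs s : ℝ) := by
        rw [ENNReal.ofReal, Real.toNNReal_of_nonneg (p.prob e x.obs s).2.1]; rfl
      have a2 : ((unitInterval.toNNReal (unitInterval.symm (p.prob e x.obs s)) : NNReal) : ℝ≥0∞)
          = ENNReal.ofReal (1 - (p.prob e x.obs s : ℝ)) := by
        rw [ENNReal.ofReal, Real.toNNReal_of_nonneg (by linarith [(p.prob e x.obs s).2.2])]; rfl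
      rw [bernoulliMeasure_def, Measure.add_apply, Measure.smul_apply, Measure.smul_apply,
        ENNReal.smul_def, ENNReal.smul_def, a1, a2, smul_eq_mul, smul_eq_mul]
    rw [key]
    exact (h1.mul_const _).add (h2.mul_const _)

instance (p : Policy emax S) (e : Fin (emax + 1)) (s : S) :
    IsMarkovKernel (p.actionKernel e s) :=
  ⟨fun _ => inferInstanceAs (IsProbabilityMeasure (bernoulliMeasure true false _))⟩

/-- Law of a sensor's slot at energy `e` and scenario `s`: the packet is drawn from the packet
law, then the action from the policy; the harvest is independent, Bernoulli(`harvestRate s`). -/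
noncomputable def Network.localLaw (N : Network S) (p : Policy emax S) (e : Fin (emax + 1))
    (s : S) : Measure LocalSlot :=
  (N.packetLaw ⊗ₘ p.actionKernel e s).prod (bernoulliMeasure true false (N.harvestRate s))

instance (N : Network S) (p : Policy emax S) (e : Fin (emax + 1)) (s : S) :
    IsProbabilityMeasure (N.localLaw p e s) := by
  unfold Network.localLaw; infer_instance

variable [MeasurableSpace S]

/-- Law of the slot record given the state: sensors act conditionally independently. -/
noncomputable def Network.slotLaw (N : Network S) (μ : JointPolicy U emax S)
    (z : SysState U emax S) : Measure (Slot U emax S) :=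
  (Measure.dirac z).prod (Measure.pi fun u => N.localLaw (μ u) (z.1 u) z.2)

instance (N : Network S) (μ : JointPolicy U emax S) (z : SysState U emax S) :
    IsProbabilityMeasure (N.slotLaw μ z) := by
  unfold Network.slotLaw; infer_instance

/-- Battery update `E ↦ min (E - Q + B) emax`. -/
def nextEnergy (e : Fin (emax + 1)) (r : LocalSlot) : Fin (emax + 1) :=
  ⟨min ((e : ℕ) - r.transmits.toNat + r.harvests.toNat) emax,
    Nat.lt_succ_of_le (min_le_right _ _)⟩

/-- Energy levels at the next slot together with the current scenario. -/
def Slot.next (z : Slot U emax S) : SysState U emax S :=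
  (fun u => nextEnergy (z.1.1 u) (z.2 u), z.1.2)

theorem measurable_next : Measurable (Slot.next : Slot U emax S → SysState U emax S) := by
  have hg : Measurable fun t : Fin (emax + 1) × Bool × Bool =>
      (⟨min ((t.1 : ℕ) - t.2.1.toNat + t.2.2.toNat) emax,
        Nat.lt_succ_of_le (min_le_right _ _)⟩ : Fin (emax + 1)) := measurable_of_countable _
  refine Measurable.prodMk (measurable_pi_lambda _ fun u => ?_) (by fun_prop)
  have h : Measurable fun z : Slot U emax S => (z.1.1 u, (z.2 u).1.2, (z.2 u).2) := by fun_prop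
  exact hg.comp h

variable [Fintype S] [DiscreteMeasurableSpace S]

/-- One-step kernel: the energies are updated, the scenario moves according to its Markov chain,
and the new slot is drawn given the new state. -/
noncomputable def Network.stepKernel (N : Network S) (μ : JointPolicy U emax S) :
    Kernel (Slot U emax S) (Slot U emax S) :=
  (Kernel.ofFunOfCountable fun w : SysState U emax S =>
    ∑ s' : S, N.scenarioTrans w.2 s' • N.slotLaw μ (w.1, s')).comap Slot.next measurable_next

instance (N : Network S) (μ : JointPolicy U emax S) : IsMarkovKernel (N.stepKernel μ) := by
  refine ⟨fun z => ⟨?_⟩⟩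
  have h : ∑ s' : S, N.scenarioTrans z.next.2 s' = 1 := by
    exact (tsum_fintype _).symm.trans (N.scenarioTrans z.next.2).tsum_coe
  change (∑ s' : S, N.scenarioTrans z.next.2 s' • N.slotLaw μ (z.next.1, s')) Set.univ = 1
  rw [Measure.finsetSum_apply]
  simpa using h

/-- Law of the whole slot sequence under the joint policy `μ`, started at `z = (𝐞₀, s₀)`. -/
noncomputable def Network.pathLaw (N : Network S) (μ : JointPolicy U emax S)
    (z : SysState U emax S) : Measure (ℕ → Slot U emax S) :=
  Kernel.trajMeasure (X := fun _ => Slot U emax S) (N.slotLaw μ z) fun n =>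
    (N.stepKernel μ).comap (fun h => h ⟨n, Finset.mem_Iic.2 le_rfl⟩) (measurable_pi_apply _)

/-- Utility reported by sensor `u` in a slot:
`χ(γ_u > γ_th(Y_u)) Q_u V_u ∏_{i ≠ u} (1 - Q_i)`. -/
noncomputable def Network.reportedUtility (N : Network S) (u : Fin U) (z : Slot U emax S) : ℝ :=
  N.deliveredUtility (z.2 u).packet * ((z.2 u).transmits.toNat : ℝ) *
    ∏ i ∈ Finset.univ.erase u, (1 - ((z.2 i).transmits.toNat : ℝ))

/-- Average long-term utility reported by sensor `u`, from the initial state `z = (𝐞₀, s₀)`. -/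
noncomputable def Network.sensorUtility (N : Network S) (μ : JointPolicy U emax S) (u : Fin U)
    (z : SysState U emax S) : ℝ :=
  liminf (fun K : ℕ => (1 / (K : ℝ)) *
    ∫ ω, ∑ k ∈ Finset.range K, N.reportedUtility u (ω k) ∂(N.pathLaw μ z)) atTop

/-- Network utility `R_μ(𝐞₀, s₀)`. -/
noncomputable def Network.networkUtility (N : Network S) (μ : JointPolicy U emax S)
    (z : SysState U emax S) : ℝ :=
  ∑ u, N.sensorUtility μ u z

/-- `μ` maximizes the network utility from the initial state `z` among all joint stationary
randomized policies. -/
def Network.IsOptimal (N : Network S) (μ : JointPolicy U emax S) (z : SysState U emax S) : Prop :=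
  ∀ ν : JointPolicy U emax S, N.networkUtility ν z ≤ N.networkUtility μ z

/-- Transmission probability `𝔼[μ(e, Y, s)]` at energy `e` in scenario `s`. -/
noncomputable def Network.transmitProb (N : Network S) (p : Policy emax S) (e : Fin (emax + 1))
    (s : S) : ℝ :=
  ∫ x, (p.prob e x.obs s : ℝ) ∂N.packetLaw

/-- Long-run fraction of slots in which sensor `u` has energy `e`, the scenario is `s`, and every
other sensor stays idle. -/
noncomputable def Network.clearFrequency (N : Network S) (μ : JointPolicy U emax S)
    (z : SysState U emax S) (u : Fin U) (e : Fin (emax + 1)) (s : S) : ℝ :=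
  liminf (fun K : ℕ => (1 / (K : ℝ)) * ∑ k ∈ Finset.range K,
    (N.pathLaw μ z).real {ω | (ω k).1.1 u = e ∧ (ω k).1.2 = s ∧
      ∀ i, i ≠ u → ((ω k).2 i).transmits = false}) atTop

end Dynamics

/-- The threshold rule `χ(y ≥ t)`; the threshold `t` may be `0` (always transmit) or `∞` (never
transmit). -/
noncomputable def thresholdRule (t : ℝ≥0∞) (y : ℝ) : unitInterval :=
  if t ≤ ENNReal.ofReal y then 1 else 0

/-- The joint policy `μ` is the threshold rule on the observation with thresholds `t u e s`. -/
def JointPolicy.IsThreshold {U emax : ℕ} {S : Type*} (μ : JointPolicy U emax S)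
    (t : Fin U → Fin (emax + 1) → S → ℝ≥0∞) : Prop :=
  ∀ u e s, ∀ y : ℝ, 0 < y → (μ u).prob e y s = thresholdRule (t u e s) y

/-! The battery update reads only the action `Q` and the harvest `B`, and packets are fresh in every
slot. Hence a policy influences the law of the states, and the idleness of each sensor in a given
state, only through the numbers `transmitProb`. This is `exists_pathLaw_map_eq_sum`.

Given the state, the packet and action of sensor `u` are independent of the other sensors' actions.
Its expected utility in slot `k` is therefore the sum over `(e, s)` of `transmitGain` times the
probability that `u` is at `(e, s)` and all others are idle (`integral_pathLaw_reportedUtility`).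
The second factor depends on transmission probabilities alone.

It remains to maximize each gain at a fixed transmission probability. Conditioning on `Y` turns the
gain into the mean of `Vbar` times the decision rule, and the Neyman–Pearson argument shows that an
upper threshold is the a.s. unique maximizer (`exists_threshold`).

The comparison holds at every finite horizon, so it passes to the liminf. Where clear slots have
positive frequency, a strict gain adds a positive constant to all late averages
(`sensorUtility_lt`), which contradicts optimality. -/

/-! ### One-dimensional marginals of trajectory measures. -/

namespace ProbabilityTheory.Kernel

variable {X : ℕ → Type*} [∀ n, MeasurableSpace (X n)]

theorem trajMeasure_map_zero (μ₀ : Measure (X 0)) [IsProbabilityMeasure μ₀]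
    (κ : (n : ℕ) → Kernel (Π i : Finset.Iic n, X i) (X (n + 1))) [∀ n, IsMarkovKernel (κ n)] :
    (trajMeasure μ₀ κ).map (fun x => x 0) = μ₀ := by
  have hf : (fun x : Π n, X n => x 0) =
      (fun x : Π i : Finset.Iic 0, X i => x ⟨0, Finset.mem_Iic.2 le_rfl⟩) ∘
        Preorder.frestrictLe 0 := rfl
  rw [hf, ← Measure.map_map (by fun_prop) (by fun_prop), trajMeasure,
    Measure.map_comp _ _ (by fun_prop), traj_map_frestrictLe, partialTraj_self, Measure.id_comp]
  exact (Measure.map_map (measurable_pi_apply _)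
    (MeasurableEquiv.measurable (MeasurableEquiv.piUnique _).symm)).trans Measure.map_id

/-- One-dimensional marginals of a trajectory whose transitions depend on the present only. -/
theorem trajMeasure_map_succ (μ₀ : Measure (X 0)) [IsProbabilityMeasure μ₀]
    (κ : (n : ℕ) → Kernel (Π i : Finset.Iic n, X i) (X (n + 1))) [∀ n, IsMarkovKernel (κ n)]
    (η : (n : ℕ) → Kernel (X n) (X (n + 1))) (n : ℕ)
    (hκ : κ n = (η n).comap (fun h => h ⟨n, Finset.mem_Iic.2 le_rfl⟩) (measurable_pi_apply _)) :
    (trajMeasure μ₀ κ).map (fun x => x (n + 1)) =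
      η n ∘ₘ (trajMeasure μ₀ κ).map (fun x => x n) := by
  have h := congrArg (Measure.map Prod.snd)
    (map_frestrictLe_trajMeasure_compProd_eq_map_trajMeasure (μ₀ := μ₀) (κ := κ) (a := n))
  rw [Measure.map_map (by fun_prop) (by fun_prop)] at h
  have h' : (trajMeasure μ₀ κ).map (fun x => x (n + 1)) =
      κ n ∘ₘ (trajMeasure μ₀ κ).map (Preorder.frestrictLe n) := by
    rw [← Measure.snd_compProd]; exact h.symm
  rw [h', hκ]
  have hf : (fun x : Π n, X n => x n) =
      (fun x : Π i : Finset.Iic n, X i => x ⟨n, Finset.mem_Iic.2 le_rfl⟩) ∘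
        Preorder.frestrictLe n := rfl
  rw [hf, ← Measure.map_map (by fun_prop) (by fun_prop),
    ← Measure.deterministic_comp_eq_map (measurable_pi_apply _), Measure.comp_assoc,
    comp_deterministic_eq_comap]

end ProbabilityTheory.Kernel

/-! ### Slot laws and transmission probabilities. -/

section StateLaw

variable {U emax : ℕ} {S : Type*}

theorem Policy.actionKernel_apply_true (p : Policy emax S) (e : Fin (emax + 1)) (s : S)
    (x : Packet) : p.actionKernel e s x {true} = ENNReal.ofReal (p.prob e x.obs s) := by
  change bernoulliMeasure true false (p.prob e x.obs s) {true} = _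
  rw [bernoulliMeasure_apply_of_mem_of_notMem _ (measurableSet_singleton _) (Set.mem_singleton _) (by simp)]
  rw [ENNReal.ofReal, Real.toNNReal_of_nonneg (p.prob e x.obs s).2.1]; rfl

theorem Policy.measurable_prob_obs (p : Policy emax S) (e : Fin (emax + 1)) (s : S) :
    Measurable fun x : Packet => (p.prob e x.obs s : ℝ) :=
  measurable_subtype_coe.comp ((p.measurable_prob e s).comp Packet.measurable_obs)

theorem Policy.norm_prob_le_one (p : Policy emax S) (e : Fin (emax + 1)) (s : S) (y : ℝ) :
    ‖(p.prob e y s : ℝ)‖ ≤ 1 := by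
  rw [Real.norm_of_nonneg (p.prob e y s).2.1]; exact (p.prob e y s).2.2

theorem Network.integrable_prob (N : Network S) (p : Policy emax S) (e : Fin (emax + 1)) (s : S) :
    Integrable (fun x : Packet => (p.prob e x.obs s : ℝ)) N.packetLaw :=
  Integrable.of_bound (p.measurable_prob_obs e s).aestronglyMeasurable 1
    (ae_of_all _ fun x => p.norm_prob_le_one e s x.obs)

theorem Network.snd_actionKernel_apply_true (N : Network S) (p : Policy emax S)
    (e : Fin (emax + 1)) (s : S) :
    (N.packetLaw ⊗ₘ p.actionKernel e s).snd {true} = ENNReal.ofReal (N.transmitProb p e s) := by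
  rw [Measure.snd_compProd, Measure.bind_apply (by simp) (Kernel.aemeasurable _)]
  simp_rw [Policy.actionKernel_apply_true]
  rw [← ofReal_integral_eq_lintegral_ofReal (N.integrable_prob p e s)
    (ae_of_all _ fun x => (p.prob e x.obs s).2.1)]
  rfl

theorem Network.snd_actionKernel_congr (N : Network S) {p q : Policy emax S}
    {e : Fin (emax + 1)} {s : S} (h : N.transmitProb p e s = N.transmitProb q e s) :
    (N.packetLaw ⊗ₘ p.actionKernel e s).snd = (N.packetLaw ⊗ₘ q.actionKernel e s).snd := by
  have ht : (N.packetLaw ⊗ₘ p.actionKernel e s).snd {true} =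
      (N.packetLaw ⊗ₘ q.actionKernel e s).snd {true} := by
    rw [snd_actionKernel_apply_true, snd_actionKernel_apply_true, h]
  have hf : ({false} : Set Bool) = {true}ᶜ := by ext b; cases b <;> simp
  refine Measure.ext_of_singleton fun b => ?_
  cases b
  · rw [hf, prob_compl_eq_one_sub (by simp), prob_compl_eq_one_sub (by simp), ht]
  · exact ht

/-- The projection forgets the packet and keeps `(Q, B)`, all that the battery update reads; the law
of `Q` is Bernoulli with the transmission probability as mean. -/
theorem Network.localLaw_map_congr (N : Network S) {p q : Policy emax S}
    {e : Fin (emax + 1)} {s : S} (h : N.transmitProb p e s = N.transmitProb q e s) :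
    (N.localLaw p e s).map (Prod.map Prod.snd id) =
      (N.localLaw q e s).map (Prod.map Prod.snd id) := by
  unfold Network.localLaw
  rw [← Measure.map_prod_map _ _ measurable_snd measurable_id,
    ← Measure.map_prod_map _ _ measurable_snd measurable_id]
  exact congrArg (fun m => Measure.prod m _) (N.snd_actionKernel_congr h)

variable [MeasurableSpace S]

theorem Network.slotLaw_map_next_congr (N : Network S) {μ ν : JointPolicy U emax S}
    (h : ∀ u e s, N.transmitProb (μ u) e s = N.transmitProb (ν u) e s) (z : SysState U emax S) :
    (N.slotLaw μ z).map Slot.next = (N.slotLaw ν z).map Slot.next := by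
  -- `Slot.next` factors through the map that forgets the packets; the packet `0` is a dummy value.
  have key : ∀ κ : JointPolicy U emax S, (N.slotLaw κ z).map Slot.next =
      (((Measure.dirac z).prod (Measure.pi fun u =>
        (N.localLaw (κ u) (z.1 u) z.2).map (Prod.map Prod.snd id))).map
      (fun w : SysState U emax S × (Fin U → Bool × Bool) =>
        (Slot.next (w.1, fun u => ((0, (w.2 u).1), (w.2 u).2)) : SysState U emax S))) := by
    intro κ
    rw [← Measure.pi_map_pi (μ := fun u => N.localLaw (κ u) (z.1 u) z.2)
      (f := fun _ => Prod.map Prod.snd id) (fun i => by fun_prop)]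
    conv_rhs => rw [← Measure.map_id (μ := Measure.dirac z)]
    rw [Measure.map_prod_map _ _ measurable_id (by fun_prop)]
    have hg : Measurable fun w : SysState U emax S × (Fin U → Bool × Bool) =>
        ((w.1, fun u => ((0, (w.2 u).1), (w.2 u).2)) : Slot U emax S) := by fun_prop
    have hm : Measurable (Prod.map id (fun (x : Fin U → LocalSlot) i => Prod.map Prod.snd id (x i)) :
        Slot U emax S → SysState U emax S × (Fin U → Bool × Bool)) := by fun_prop
    exact (Measure.map_map (measurable_next.comp hg) hm).symm
  rw [key μ, key ν]
  simp_rw [fun u => N.localLaw_map_congr (h u (z.1 u) z.2)]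

variable [Fintype S] [DiscreteMeasurableSpace S]

theorem Network.pathLaw_map_zero (N : Network S) (μ : JointPolicy U emax S)
    (z : SysState U emax S) : (N.pathLaw μ z).map (fun ω => ω 0) = N.slotLaw μ z :=
  Kernel.trajMeasure_map_zero (X := fun _ => Slot U emax S) _ _

theorem Network.pathLaw_map_succ (N : Network S) (μ : JointPolicy U emax S)
    (z : SysState U emax S) (k : ℕ) :
    (N.pathLaw μ z).map (fun ω => ω (k + 1)) =
      N.stepKernel μ ∘ₘ (N.pathLaw μ z).map (fun ω => ω k) :=
  Kernel.trajMeasure_map_succ (X := fun _ => Slot U emax S) _ _ (fun _ => N.stepKernel μ) k rfl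

/-- The kernel sees `m` only through its image under `Slot.next`. That image already carries the new
energies, hence the condition `w.1 = z'.1`; only the scenario still has to move. -/
theorem Network.stepKernel_comp (N : Network S) (μ : JointPolicy U emax S)
    (m : Measure (Slot U emax S)) :
    N.stepKernel μ ∘ₘ m = ∑ z' : SysState U emax S,
      (∑ w : SysState U emax S, if w.1 = z'.1 then
        m.map Slot.next {w} * N.scenarioTrans w.2 z'.2 else 0) • N.slotLaw μ z' := by
  ext t ht
  rw [Measure.bind_apply ht (Kernel.aemeasurable _), Measure.finsetSum_apply]
  have h1 : ∀ x, N.stepKernel μ x t = (fun w : SysState U emax S =>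
      ∑ s' : S, N.scenarioTrans w.2 s' * N.slotLaw μ (w.1, s') t) (Slot.next x) := by
    intro x
    change (∑ s' : S, N.scenarioTrans x.next.2 s' • N.slotLaw μ (x.next.1, s')) t = _
    rw [Measure.finsetSum_apply]; rfl
  rw [lintegral_congr h1]
  refine (lintegral_map (f := fun w : SysState U emax S => ∑ s' : S, N.scenarioTrans w.2 s' *
    N.slotLaw μ (w.1, s') t) (measurable_of_countable _) measurable_next).symm.trans ?_
  rw [lintegral_fintype]
  simp_rw [Measure.smul_apply, smul_eq_mul, Finset.sum_mul]
  refine Eq.trans ?_ Finset.sum_comm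
  refine Finset.sum_congr rfl fun w _ => ?_
  rw [Fintype.sum_prod_type]
  simp_rw [ite_mul, zero_mul]
  rw [Finset.sum_comm]
  simp only [Finset.sum_ite_eq, Finset.mem_univ, if_true]
  exact Finset.sum_congr rfl fun s' _ => by ring

/-- The law of a slot is a mixture of the conditional slot laws, with weights that depend on the
policy through its transmission probabilities only. -/
theorem Network.exists_pathLaw_map_eq_sum (N : Network S) {μ ν : JointPolicy U emax S}
    (h : ∀ u e s, N.transmitProb (μ u) e s = N.transmitProb (ν u) e s)
    (z : SysState U emax S) (k : ℕ) : ∃ w : SysState U emax S → ℝ≥0∞, (∀ z', w z' ≠ ∞) ∧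
      (N.pathLaw μ z).map (fun ω => ω k) = ∑ z', w z' • N.slotLaw μ z' ∧
      (N.pathLaw ν z).map (fun ω => ω k) = ∑ z', w z' • N.slotLaw ν z' := by
  classical
  induction k with
  | zero =>
    refine ⟨fun z' => if z' = z then 1 else 0, fun z' => by dsimp only; split_ifs <;> simp, ?_, ?_⟩ <;>
    simp [pathLaw_map_zero, ite_smul]
  | succ k ih =>
    obtain ⟨w, hw, h1, h2⟩ := ih
    -- Equal weights and equal images of the components: both policies lead to the same law of
    -- `Slot.next`, hence to the same weights in the next slot.
    have hm : ((N.pathLaw ν z).map (fun ω => ω k)).map Slot.next =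
        ((N.pathLaw μ z).map (fun ω => ω k)).map Slot.next := by
      rw [h1, h2]
      simp_rw [← Measure.mapₗ_apply_of_measurable measurable_next, map_sum, map_smul,
        Measure.mapₗ_apply_of_measurable measurable_next, N.slotLaw_map_next_congr h]
    refine ⟨_, ?_, (N.pathLaw_map_succ μ z k).trans (N.stepKernel_comp μ _), ?_⟩
    · intro z'
      have : IsProbabilityMeasure (N.pathLaw μ z) := by unfold Network.pathLaw; infer_instance
      have : IsFiniteMeasure (((N.pathLaw μ z).map (fun ω => ω k)).map Slot.next) := inferInstance
      refine ENNReal.sum_ne_top.2 fun w' _ => ?_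
      split_ifs
      · exact ENNReal.mul_ne_top (measure_ne_top _ _) (PMF.apply_ne_top _ _)
      · simp
    · rw [← hm]
      exact (N.pathLaw_map_succ ν z k).trans (N.stepKernel_comp ν _)

end StateLaw

/-! ### Product integrals over independent coordinates. -/

theorem MeasureTheory.measureReal_finsetSum_apply {ι α : Type*} [MeasurableSpace α]
    (t : Finset ι) (m : ι → Measure α) [∀ i, IsFiniteMeasure (m i)] (A : Set α) :
    (∑ i ∈ t, m i).real A = ∑ i ∈ t, (m i).real A := by
  simp only [measureReal_def]
  rw [Measure.finsetSum_apply, ENNReal.toReal_sum fun i _ => measure_ne_top _ _]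

/-- Inserting `f` as the factor of index `u` gives a product over all coordinates, to which Fubini
applies. Here `f` will carry sensor `u` and `h` the idleness of the others. -/
theorem MeasureTheory.integral_pi_mul_prod_erase {ι : Type*} [Fintype ι] [DecidableEq ι]
    {E : Type*} [MeasurableSpace E] (m : ι → Measure E) [∀ i, SigmaFinite (m i)] (u : ι)
    (f : E → ℝ) (h : ι → E → ℝ) :
    ∫ x, f (x u) * ∏ i ∈ Finset.univ.erase u, h i (x i) ∂Measure.pi m =
      (∫ y, f y ∂m u) * ∏ i ∈ Finset.univ.erase u, ∫ y, h i y ∂m i := by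
  have h1 : ∀ x : ι → E, f (x u) * ∏ i ∈ Finset.univ.erase u, h i (x i) =
      ∏ i, Function.update h u f i (x i) := by
    intro x
    rw [← Finset.mul_prod_erase _ _ (Finset.mem_univ u), Function.update_self]
    congr 1
    exact Finset.prod_congr rfl fun i hi => by
      rw [Function.update_of_ne (Finset.ne_of_mem_erase hi)]
  simp_rw [h1]
  rw [integral_fintype_prod_eq_prod, ← Finset.mul_prod_erase _ _ (Finset.mem_univ u),
    Function.update_self]
  congr 1
  exact Finset.prod_congr rfl fun i hi => by
    rw [Function.update_of_ne (Finset.ne_of_mem_erase hi)]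

theorem MeasureTheory.Integrable.pi_mul_prod_erase {ι : Type*} [Fintype ι] [DecidableEq ι]
    {E : Type*} [MeasurableSpace E] {m : ι → Measure E} [∀ i, SigmaFinite (m i)] {u : ι}
    {f : E → ℝ} {h : ι → E → ℝ} (hf : Integrable f (m u)) (hh : ∀ i, Integrable (h i) (m i)) :
    Integrable (fun x : ι → E => f (x u) * ∏ i ∈ Finset.univ.erase u, h i (x i))
      (Measure.pi m) := by
  have h1 : (fun x : ι → E => f (x u) * ∏ i ∈ Finset.univ.erase u, h i (x i)) =
      fun x => ∏ i, Function.update h u f i (x i) := by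
    ext x
    rw [← Finset.mul_prod_erase _ _ (Finset.mem_univ u), Function.update_self]
    congr 1
    exact Finset.prod_congr rfl fun i hi => by
      rw [Function.update_of_ne (Finset.ne_of_mem_erase hi)]
  rw [h1]
  refine Integrable.fintype_prod fun i => ?_
  by_cases hi : i = u
  · subst hi; rwa [Function.update_self]
  · rw [Function.update_of_ne hi]; exact hh i

/-! ### Expected utility of a slot: gain times probability of a clear channel. -/

section SlotIntegral

variable {U emax : ℕ} {S : Type*}

theorem Network.measurable_deliveredUtility (N : Network S) : Measurable N.deliveredUtility := by
  unfold Network.deliveredUtility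
  refine Measurable.ite (measurableSet_lt (N.measurable_snrThreshold.comp Packet.measurable_obs)
    (measurable_snd.comp measurable_snd)) measurable_fst measurable_const

theorem Network.integrable_localLaw_of_packet (N : Network S) (p : Policy emax S)
    (e : Fin (emax + 1)) (s : S) {h : Packet → ℝ} (hh : Integrable h N.packetLaw) :
    Integrable (fun x : Packet × Bool => h x.1 * (x.2.toNat : ℝ))
      (N.packetLaw ⊗ₘ p.actionKernel e s) := by
  have h1 : Integrable (fun x : Packet × Bool => h x.1) (N.packetLaw ⊗ₘ p.actionKernel e s) := by
    refine Integrable.comp_measurable (f := Prod.fst) ?_ measurable_fst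
    have := Measure.fst_compProd N.packetLaw (p.actionKernel e s)
    rw [Measure.fst] at this
    rwa [this]
  have hm : Measurable fun x : Packet × Bool => (x.2.toNat : ℝ) :=
    (measurable_of_countable fun b : Bool => (b.toNat : ℝ)).comp measurable_snd
  refine h1.mul_bdd (c := 1) hm.aestronglyMeasurable (ae_of_all _ fun x => ?_)
  cases x.2 <;> simp

theorem Network.integrable_localLaw (N : Network S) (p : Policy emax S) (e : Fin (emax + 1))
    (s : S) {h : Packet → ℝ} (hh : Integrable h N.packetLaw) :
    Integrable (fun r : LocalSlot => h r.packet * (r.transmits.toNat : ℝ)) (N.localLaw p e s) :=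
  (N.integrable_localLaw_of_packet p e s hh).comp_fst _

theorem Network.integral_localLaw (N : Network S) (p : Policy emax S) (e : Fin (emax + 1))
    (s : S) {h : Packet → ℝ} (hh : Integrable h N.packetLaw) :
    ∫ r, h r.packet * (r.transmits.toNat : ℝ) ∂N.localLaw p e s =
      ∫ x, h x * (p.prob e x.obs s : ℝ) ∂N.packetLaw := by
  have h1 : ∫ r, h r.packet * (r.transmits.toNat : ℝ) ∂N.localLaw p e s =
      ∫ x : Packet × Bool, h x.1 * (x.2.toNat : ℝ) ∂(N.packetLaw ⊗ₘ p.actionKernel e s) := by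
    unfold Network.localLaw
    refine (integral_fun_fst (fun x : Packet × Bool => h x.1 * (x.2.toNat : ℝ))).trans ?_
    simp
  rw [h1, Measure.integral_compProd (N.integrable_localLaw_of_packet p e s hh)]
  refine integral_congr_ae (ae_of_all _ fun x => ?_)
  refine (integral_bernoulliMeasure true false (p.prob e x.obs s)
    (fun b : Bool => h x * (b.toNat : ℝ))).trans ?_
  simp [mul_comm]

theorem Network.integrable_idle (N : Network S) (p : Policy emax S) (e : Fin (emax + 1)) (s : S) :
    Integrable (fun r : LocalSlot => 1 - (r.transmits.toNat : ℝ)) (N.localLaw p e s) := by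
  have := N.integrable_localLaw p e s (integrable_const (1 : ℝ))
  simp_rw [one_mul] at this
  exact (integrable_const _).sub this

theorem Network.integral_idle (N : Network S) (p : Policy emax S) (e : Fin (emax + 1)) (s : S) :
    ∫ r, (1 - (r.transmits.toNat : ℝ)) ∂N.localLaw p e s = 1 - N.transmitProb p e s := by
  have h0 := N.integrable_localLaw p e s (integrable_const (1 : ℝ))
  have h1 := N.integral_localLaw p e s (integrable_const (1 : ℝ))
  simp_rw [one_mul] at h0 h1
  rw [integral_sub (integrable_const _) h0, h1]
  simp [Network.transmitProb]

/-- Expected utility of a transmission attempt at energy `e` in scenario `s`, absent collisions. -/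
noncomputable def Network.transmitGain (N : Network S) (p : Policy emax S) (e : Fin (emax + 1))
    (s : S) : ℝ :=
  ∫ x, N.deliveredUtility x * (p.prob e x.obs s : ℝ) ∂N.packetLaw

/-- Probability that all sensors but `u` stay idle in state `z`. -/
noncomputable def Network.clearProb (N : Network S) (μ : JointPolicy U emax S) (u : Fin U)
    (z : SysState U emax S) : ℝ :=
  ∏ i ∈ Finset.univ.erase u, (1 - N.transmitProb (μ i) (z.1 i) z.2)

/-- The slots in which `u` has energy `e`, the scenario is `s` and all other sensors are idle. -/
def clearSlots (u : Fin U) (e : Fin (emax + 1)) (s : S) : Set (Slot U emax S) :=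
  {x | x.1.1 u = e ∧ x.1.2 = s ∧ ∀ i, i ≠ u → (x.2 i).transmits = false}

variable [MeasurableSpace S]

theorem Network.measurable_reportedUtility (N : Network S) (u : Fin U) :
    Measurable (N.reportedUtility u : Slot U emax S → ℝ) := by
  have hb : ∀ i, Measurable fun x : Slot U emax S => ((x.2 i).transmits.toNat : ℝ) := fun i =>
    (measurable_of_countable fun b : Bool => (b.toNat : ℝ)).comp
      (show Measurable fun x : Slot U emax S => (x.2 i).1.2 by fun_prop)
  have hp : Measurable fun x : Slot U emax S => (x.2 u).packet :=
    show Measurable fun x : Slot U emax S => (x.2 u).1.1 by fun_prop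
  exact ((N.measurable_deliveredUtility.comp hp).mul (hb u)).mul
    (Finset.measurable_prod _ fun i _ => (hb i).const_sub 1)

theorem measurableSet_clearSlots [DiscreteMeasurableSpace S] (u : Fin U) (e : Fin (emax + 1))
    (s : S) : MeasurableSet (clearSlots u e s : Set (Slot U emax S)) := by
  have h1 : Measurable fun x : Slot U emax S => x.1.1 u := by fun_prop
  have h2 : Measurable fun x : Slot U emax S => x.1.2 := by fun_prop
  have h3 : ∀ i, Measurable fun x : Slot U emax S => (x.2 i).transmits := fun i =>
    show Measurable fun x : Slot U emax S => (x.2 i).1.2 by fun_prop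
  have h4 : (clearSlots u e s : Set (Slot U emax S)) = (fun x => x.1.1 u) ⁻¹' {e} ∩
      ((fun x => x.1.2) ⁻¹' {s} ∩
        ⋂ i, ⋂ (_ : i ≠ u), (fun x => (x.2 i).transmits) ⁻¹' {false}) := by
    ext x; simp [clearSlots]
  rw [h4]
  exact (h1 (.singleton e)).inter ((h2 (.singleton s)).inter
    (.iInter fun i => .iInter fun _ => h3 i (.singleton false)))

theorem Network.integrable_reportedUtility (N : Network S)
    (hD : Integrable N.deliveredUtility N.packetLaw) (μ : JointPolicy U emax S) (u : Fin U)
    (z : SysState U emax S) : Integrable (N.reportedUtility u) (N.slotLaw μ z) := by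
  unfold Network.slotLaw
  rw [Measure.dirac_prod, integrable_map_measure
    (N.measurable_reportedUtility u).aestronglyMeasurable measurable_prodMk_left.aemeasurable]
  exact Integrable.pi_mul_prod_erase (m := fun u => N.localLaw (μ u) (z.1 u) z.2)
    (N.integrable_localLaw (μ u) (z.1 u) z.2 hD) (fun i => N.integrable_idle (μ i) (z.1 i) z.2)

theorem Network.integral_reportedUtility (N : Network S)
    (hD : Integrable N.deliveredUtility N.packetLaw) (μ : JointPolicy U emax S) (u : Fin U)
    (z : SysState U emax S) : ∫ x, N.reportedUtility u x ∂N.slotLaw μ z =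
      N.transmitGain (μ u) (z.1 u) z.2 * N.clearProb μ u z := by
  unfold Network.slotLaw
  rw [Measure.dirac_prod, integral_map measurable_prodMk_left.aemeasurable
    (N.measurable_reportedUtility u).aestronglyMeasurable]
  refine (integral_pi_mul_prod_erase (fun u => N.localLaw (μ u) (z.1 u) z.2) u
    (fun r => N.deliveredUtility r.packet * (r.transmits.toNat : ℝ))
    (fun _ r => 1 - (r.transmits.toNat : ℝ))).trans ?_
  rw [N.integral_localLaw _ _ _ hD]
  simp_rw [N.integral_idle]
  rfl

theorem Network.slotLaw_clearSlots [DiscreteMeasurableSpace S] [DecidableEq S] (N : Network S)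
    (μ : JointPolicy U emax S)
    (u : Fin U) (e : Fin (emax + 1)) (s : S) (z : SysState U emax S) :
    (N.slotLaw μ z).real (clearSlots u e s) =
      if z.1 u = e ∧ z.2 = s then N.clearProb μ u z else 0 := by
  rw [← integral_indicator_one (measurableSet_clearSlots u e s)]
  unfold Network.slotLaw
  rw [Measure.dirac_prod, integral_map measurable_prodMk_left.aemeasurable
    (measurable_one.indicator (measurableSet_clearSlots u e s)).aestronglyMeasurable]
  have key : ∀ x : Fin U → LocalSlot, (clearSlots u e s).indicator (1 : Slot U emax S → ℝ) (z, x) =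
      (if z.1 u = e ∧ z.2 = s then 1 else 0) *
        ∏ i ∈ Finset.univ.erase u, (1 - ((x i).transmits.toNat : ℝ)) := by
    intro x
    by_cases hz : z.1 u = e ∧ z.2 = s
    · rw [if_pos hz, one_mul]
      by_cases hx : ∀ i, i ≠ u → (x i).transmits = false
      · rw [Set.indicator_of_mem (show (z, x) ∈ clearSlots u e s from ⟨hz.1, hz.2, hx⟩)]
        refine (Finset.prod_eq_one fun i hi => ?_).symm
        simp [hx i (Finset.ne_of_mem_erase hi)]
      · rw [Set.indicator_of_notMem fun h => hx h.2.2]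
        push Not at hx
        obtain ⟨i, hi, hxi⟩ := hx
        refine (Finset.prod_eq_zero (Finset.mem_erase.2 ⟨hi, Finset.mem_univ i⟩) ?_).symm
        simp [hxi]
    · rw [if_neg hz, zero_mul, Set.indicator_of_notMem fun h => hz ⟨h.1, h.2.1⟩]
  simp_rw [key]
  -- The factor of sensor `u` is constant, since its own action is left free in a clear slot.
  refine (integral_pi_mul_prod_erase (fun u => N.localLaw (μ u) (z.1 u) z.2) u
    (fun _ => if z.1 u = e ∧ z.2 = s then (1 : ℝ) else 0)
    (fun _ r => 1 - (r.transmits.toNat : ℝ))).trans ?_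
  simp_rw [N.integral_idle]
  simp [Network.clearProb]

theorem measurable_slot (k : ℕ) : Measurable fun ω : ℕ → Slot U emax S => ω k :=
  measurable_pi_apply k

variable [Fintype S] [DiscreteMeasurableSpace S]

instance (N : Network S) (μ : JointPolicy U emax S) (z : SysState U emax S) :
    IsProbabilityMeasure (N.pathLaw μ z) := by
  unfold Network.pathLaw; infer_instance

theorem Network.integrable_pathLaw_reportedUtility (N : Network S)
    (hD : Integrable N.deliveredUtility N.packetLaw) (μ : JointPolicy U emax S) (u : Fin U)
    (z : SysState U emax S) (k : ℕ) :
    Integrable (fun ω => N.reportedUtility u (ω k)) (N.pathLaw μ z) := by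
  obtain ⟨w, hw, h, -⟩ := N.exists_pathLaw_map_eq_sum (μ := μ) (fun _ _ _ => rfl) z k
  refine Integrable.comp_measurable (g := N.reportedUtility u) ?_ (measurable_slot k)
  rw [h, integrable_finsetSum_measure]
  exact fun z' _ => (N.integrable_reportedUtility hD μ u z').smul_measure (hw z')

/-- In each component of the mixture the expected utility is gain times `clearProb`, and the gain
depends on the state only through the energy of `u` and the scenario. Grouping the states by this
pair turns the weights into probabilities of clear slots. -/
theorem Network.integral_pathLaw_reportedUtility (N : Network S)
    (hD : Integrable N.deliveredUtility N.packetLaw) (μ : JointPolicy U emax S) (u : Fin U)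
    (z : SysState U emax S) (k : ℕ) :
    ∫ ω, N.reportedUtility u (ω k) ∂N.pathLaw μ z = ∑ e, ∑ s, N.transmitGain (μ u) e s *
      (N.pathLaw μ z).real ((fun ω => ω k) ⁻¹' clearSlots u e s) := by
  classical
  obtain ⟨w, hw, h, -⟩ := N.exists_pathLaw_map_eq_sum (μ := μ) (fun _ _ _ => rfl) z k
  have hfin : ∀ z', IsFiniteMeasure (w z' • N.slotLaw μ z') := fun z' =>
    Measure.smul_finite _ (hw z')
  rw [← integral_map (f := N.reportedUtility u) (measurable_slot k).aemeasurable
    (N.measurable_reportedUtility u).aestronglyMeasurable, h,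
    integral_finsetSum_measure fun z' _ =>
      (N.integrable_reportedUtility hD μ u z').smul_measure (hw z')]
  simp_rw [← map_measureReal_apply (μ := N.pathLaw μ z) (measurable_slot k)
    (measurableSet_clearSlots u _ _), h, measureReal_finsetSum_apply,
    integral_smul_measure, N.integral_reportedUtility hD, measureReal_ennreal_smul_apply,
    N.slotLaw_clearSlots, Finset.mul_sum]
  simp_rw [Finset.sum_comm (s := (Finset.univ : Finset S))]
  rw [Finset.sum_comm]
  refine Finset.sum_congr rfl fun z' _ => ?_
  -- A state `z'` contributes to the single pair `(z'.1 u, z'.2)`.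
  rw [Finset.sum_eq_single (z'.1 u), Finset.sum_eq_single z'.2]
  · simp only [and_self, if_true, smul_eq_mul]; ring
  · intro s _ hs; simp [hs.symm]
  · simp
  · intro e _ he; simp [he.symm]
  · simp

theorem Network.pathLaw_clearSlots_congr (N : Network S) {μ ν : JointPolicy U emax S}
    (h : ∀ u e s, N.transmitProb (μ u) e s = N.transmitProb (ν u) e s) (u : Fin U)
    (e : Fin (emax + 1)) (s : S) (z : SysState U emax S) (k : ℕ) :
    (N.pathLaw μ z).real ((fun ω => ω k) ⁻¹' clearSlots u e s) =
      (N.pathLaw ν z).real ((fun ω => ω k) ⁻¹' clearSlots u e s) := by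
  classical
  obtain ⟨w, hw, h1, h2⟩ := N.exists_pathLaw_map_eq_sum h z k
  have hf : ∀ z', IsFiniteMeasure (w z' • N.slotLaw μ z') := fun z' =>
    Measure.smul_finite _ (hw z')
  have hf' : ∀ z', IsFiniteMeasure (w z' • N.slotLaw ν z') := fun z' =>
    Measure.smul_finite _ (hw z')
  rw [← map_measureReal_apply (measurable_slot k) (measurableSet_clearSlots u e s),
    ← map_measureReal_apply (measurable_slot k) (measurableSet_clearSlots u e s), h1, h2]
  simp_rw [measureReal_finsetSum_apply, measureReal_ennreal_smul_apply, N.slotLaw_clearSlots,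
    Network.clearProb, h]

end SlotIntegral

/-! ### Neyman–Pearson argument for a single decision rule. -/

section NeymanPearson

theorem measurable_thresholdRule (t : ℝ≥0∞) : Measurable (thresholdRule t) :=
  Measurable.ite (measurableSet_le measurable_const ENNReal.measurable_ofReal)
    measurable_const measurable_const

theorem thresholdRule_top (y : ℝ) : thresholdRule ∞ y = 0 := by
  simp [thresholdRule]

theorem thresholdRule_zero (y : ℝ) : thresholdRule 0 y = 1 := by
  simp [thresholdRule]

theorem thresholdRule_ofReal {t : ℝ} (ht : 0 < t) (y : ℝ) :
    thresholdRule (ENNReal.ofReal t) y = if t ≤ y then 1 else 0 := by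
  unfold thresholdRule
  simp only [ENNReal.ofReal_le_ofReal_iff', not_le.2 ht, or_false]

variable {S : Type*} (N : Network S)

theorem Network.integrable_comp_obs {h : ℝ → unitInterval} (hh : Measurable h) :
    Integrable (fun x : Packet => (h x.obs : ℝ)) N.packetLaw :=
  Integrable.of_bound ((measurable_subtype_coe.comp
    (hh.comp Packet.measurable_obs)).aestronglyMeasurable) 1 (ae_of_all _ fun x => by
      rw [Real.norm_of_nonneg (h x.obs).2.1]; exact (h x.obs).2.2)

theorem Network.obs_pos : ∀ᵐ x ∂N.packetLaw, 0 < Packet.obs x := by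
  have h := N.obs_law.1
  rw [Measure.map_apply Packet.measurable_obs measurableSet_Iic] at h
  filter_upwards [measure_eq_zero_iff_ae_notMem.1 h] with x hx
  simpa using hx

theorem Network.nullSingletonClass_obs : NullSingletonClass (N.packetLaw.map Packet.obs) :=
  ⟨fun y => N.obs_law.2 (measure_singleton y)⟩

theorem Network.obs_ne (t : ℝ) : ∀ᵐ x ∂N.packetLaw, Packet.obs x ≠ t := by
  have h : N.packetLaw.map Packet.obs {t} = 0 := N.obs_law.2 (measure_singleton t)
  rw [Measure.map_apply Packet.measurable_obs (measurableSet_singleton t)] at h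
  filter_upwards [measure_eq_zero_iff_ae_notMem.1 h] with x hx
  simpa using hx

theorem Network.IsExpectedUtility.integrable {N : Network S} {Vbar : ℝ → ℝ}
    (hV : N.IsExpectedUtility Vbar) : Integrable (fun x : Packet => Vbar x.obs) N.packetLaw :=
  integrable_condExp.congr hV.2.symm

/-- The decision is a bounded function of `Y`, so it can be pulled out of the conditional
expectation given `Y`. -/
theorem Network.IsExpectedUtility.integral_mul {N : Network S} {Vbar : ℝ → ℝ}
    (hV : N.IsExpectedUtility Vbar) {h : ℝ → unitInterval} (hh : Measurable h) :
    ∫ x, N.deliveredUtility x * (h x.obs : ℝ) ∂N.packetLaw =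
      ∫ x : Packet, Vbar x.obs * (h x.obs : ℝ) ∂N.packetLaw := by
  have hm : MeasurableSpace.comap Packet.obs inferInstance ≤
      (inferInstance : MeasurableSpace Packet) := Packet.measurable_obs.comap_le
  have hs : StronglyMeasurable[MeasurableSpace.comap Packet.obs inferInstance]
      (fun x : Packet => (h x.obs : ℝ)) :=
    ((measurable_subtype_coe.comp hh).comp (comap_measurable Packet.obs)).stronglyMeasurable
  have key := condExp_stronglyMeasurable_mul_of_bound hm hs hV.1 1 (ae_of_all N.packetLaw fun x =>
    by rw [Real.norm_of_nonneg (h x.obs).2.1]; exact (h x.obs).2.2)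
  calc ∫ x, N.deliveredUtility x * (h x.obs : ℝ) ∂N.packetLaw
      = ∫ x, ((fun x : Packet => (h x.obs : ℝ)) * N.deliveredUtility) x ∂N.packetLaw :=
        integral_congr_ae (ae_of_all _ fun x => mul_comm _ _)
    _ = _ := (integral_condExp hm).symm
    _ = _ := integral_congr_ae <| by
        filter_upwards [key, hV.2] with x hx hx'
        rw [hx, Pi.mul_apply, ← hx', mul_comm]

/-- The law of `Y` has no atoms, so its distribution function is continuous and takes the value `1 -
p`. No randomization at the threshold is needed. -/
theorem Network.exists_threshold_of_mem_Ioo {p : ℝ} (hp0 : 0 < p) (hp1 : p < 1) :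
    ∃ t : ℝ, 0 < t ∧
      ∫ x : Packet, (thresholdRule (ENNReal.ofReal t) x.obs : ℝ) ∂N.packetLaw = p := by
  set m := N.packetLaw.map Packet.obs with hm
  have : IsProbabilityMeasure m := Measure.isProbabilityMeasure_map Packet.measurable_obs.aemeasurable
  have hna : NullSingletonClass m := N.nullSingletonClass_obs
  have hcont : Continuous (cdf m) := by
    refine continuous_iff_continuousAt.2 fun t => ?_
    rw [(monotone_cdf m).continuousAt_iff_leftLim_eq_rightLim, (cdf m).rightLim_eq]
    have h1 := (cdf m).measure_singleton t
    rw [measure_cdf, measure_singleton, eq_comm, ENNReal.ofReal_eq_zero] at h1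
    exact le_antisymm ((monotone_cdf m).leftLim_le le_rfl) (by linarith)
  obtain ⟨t, ht⟩ : 1 - p ∈ Set.range (cdf m) := by
    refine mem_range_of_exists_le_of_exists_ge hcont ?_ ?_
    · obtain ⟨a, ha⟩ := ((tendsto_cdf_atBot m).eventually (gt_mem_nhds (sub_pos.2 hp1))).exists
      exact ⟨a, ha.le⟩
    · obtain ⟨a, ha⟩ := ((tendsto_cdf_atTop m).eventually
        (lt_mem_nhds (by linarith : 1 - p < 1))).exists
      exact ⟨a, ha.le⟩
  -- Since `Y > 0` a.s., the distribution function vanishes up to `0` and cannot equal `1 - p > 0`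
  -- there. The threshold thus lies in `(0, ∞)`, where `Vbar` is strictly increasing.
  have h0 : cdf m 0 = 0 := by rw [cdf_eq_real, measureReal_def, hm, N.obs_law.1]; rfl
  have htpos : 0 < t := by
    by_contra! h
    have := monotone_cdf m h
    linarith
  refine ⟨t, htpos, ?_⟩
  have h1 : ∀ x : Packet, ((thresholdRule (ENNReal.ofReal t) x.obs : unitInterval) : ℝ) =
      (Set.Ici t).indicator 1 x.obs := fun x => by
    rw [thresholdRule_ofReal htpos]
    by_cases h : t ≤ x.obs <;> simp [h]
  simp_rw [h1]
  rw [← integral_map (f := (Set.Ici t).indicator (1 : ℝ → ℝ)) Packet.measurable_obs.aemeasurable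
    (measurable_one.indicator measurableSet_Ici).aestronglyMeasurable,
    integral_indicator_one measurableSet_Ici, ← Set.compl_Iio,
    probReal_compl_eq_one_sub measurableSet_Iio, measureReal_congr Iio_ae_eq_Iic, ← cdf_eq_real, ht]
  ring

variable {N} {Vbar : ℝ → ℝ}

/-- With `r` the threshold rule, `(Vbar y - Vbar t) * (r y - h y)` is nonnegative for `y > 0`: `r`
is maximal above `t` and minimal below. Its mean is the difference of the gains, as the term with
`Vbar t` cancels by `heq`. If this mean vanishes, so does the integrand a.s., and `Vbar y ≠ Vbar t`
off the null event `y = t`. -/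
theorem Network.IsExpectedUtility.threshold_optimal (hV : N.IsExpectedUtility Vbar)
    (hmono : StrictMonoOn Vbar (Set.Ioi 0)) {h : ℝ → unitInterval} (hh : Measurable h)
    {t : ℝ} (ht : 0 < t)
    (heq : ∫ x : Packet, (thresholdRule (ENNReal.ofReal t) x.obs : ℝ) ∂N.packetLaw =
      ∫ x : Packet, (h x.obs : ℝ) ∂N.packetLaw) :
    ∫ x, N.deliveredUtility x * (h x.obs : ℝ) ∂N.packetLaw ≤
      ∫ x, N.deliveredUtility x * (thresholdRule (ENNReal.ofReal t) x.obs : ℝ) ∂N.packetLaw ∧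
    (∫ x, N.deliveredUtility x * (thresholdRule (ENNReal.ofReal t) x.obs : ℝ) ∂N.packetLaw ≤
        ∫ x, N.deliveredUtility x * (h x.obs : ℝ) ∂N.packetLaw →
      ∀ᵐ x ∂N.packetLaw, h (Packet.obs x) = thresholdRule (ENNReal.ofReal t) x.obs) := by
  set r := thresholdRule (ENNReal.ofReal t) with hr
  have hrm : Measurable r := measurable_thresholdRule _
  have hint : ∀ {g : ℝ → unitInterval}, Measurable g →
      Integrable (fun x : Packet => Vbar x.obs * (g x.obs : ℝ)) N.packetLaw := fun {g} hg =>
    hV.integrable.mul_bdd (c := 1) (N.integrable_comp_obs hg).aestronglyMeasurable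
      (ae_of_all _ fun x => by
        rw [Real.norm_of_nonneg (g x.obs).2.1]; exact (g x.obs).2.2)
  have hdiff : Integrable (fun x : Packet =>
      Vbar x.obs * (r x.obs : ℝ) - Vbar x.obs * (h x.obs : ℝ)) N.packetLaw :=
    (hint hrm).sub (hint hh)
  have hdiff' : Integrable (fun x : Packet => Vbar t * ((r x.obs : ℝ) - h x.obs)) N.packetLaw :=
    ((N.integrable_comp_obs hrm).sub (N.integrable_comp_obs hh)).const_mul _
  have hrw : ∀ x : Packet, (Vbar x.obs - Vbar t) * ((r x.obs : ℝ) - h x.obs) =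
      (Vbar x.obs * (r x.obs : ℝ) - Vbar x.obs * (h x.obs : ℝ)) -
        Vbar t * ((r x.obs : ℝ) - h x.obs) := fun x => by ring
  have hval : ∫ x : Packet, (Vbar x.obs - Vbar t) * ((r x.obs : ℝ) - h x.obs) ∂N.packetLaw =
      ∫ x : Packet, Vbar x.obs * (r x.obs : ℝ) ∂N.packetLaw -
        ∫ x : Packet, Vbar x.obs * (h x.obs : ℝ) ∂N.packetLaw := by
    simp_rw [hrw]
    rw [integral_sub hdiff hdiff', integral_sub (hint hrm) (hint hh), integral_const_mul,
      integral_sub (N.integrable_comp_obs hrm) (N.integrable_comp_obs hh), heq]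
    ring
  have hnonneg : 0 ≤ᵐ[N.packetLaw]
      fun x : Packet => (Vbar x.obs - Vbar t) * ((r x.obs : ℝ) - h x.obs) := by
    filter_upwards [N.obs_pos] with x hx
    rw [hr, thresholdRule_ofReal ht]
    split_ifs with hle
    · exact mul_nonneg (sub_nonneg.2 (hmono.monotoneOn ht hx hle))
        (sub_nonneg.2 (h x.obs).2.2)
    · refine mul_nonneg_of_nonpos_of_nonpos
        (sub_nonpos.2 (hmono.monotoneOn hx ht (not_le.1 hle).le)) ?_
      simpa using (h x.obs).2.1
  rw [hV.integral_mul hh, hV.integral_mul hrm]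
  have h0 := integral_nonneg_of_ae hnonneg
  refine ⟨by linarith, fun hle => ?_⟩
  have hzero := (integral_eq_zero_iff_of_nonneg_ae hnonneg (by
    simp_rw [hrw]; exact hdiff.sub hdiff')).1
    (by linarith)
  filter_upwards [hzero, N.obs_pos, N.obs_ne t] with x hx hpos hne
  rcases mul_eq_zero.1 hx with h1 | h1
  · exact absurd (hmono.injOn hpos ht (sub_eq_zero.1 h1)) hne
  · exact Subtype.ext (sub_eq_zero.1 h1).symm

/-- Among the transmission rules of a given transmission probability, a threshold rule maximizes
the expected utility, and it is the almost surely unique maximizer. -/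
theorem Network.IsExpectedUtility.exists_threshold (hV : N.IsExpectedUtility Vbar)
    (hmono : StrictMonoOn Vbar (Set.Ioi 0)) {h : ℝ → unitInterval} (hh : Measurable h) :
    ∃ t : ℝ≥0∞, ((∀ y, h y = 0) → t = ∞) ∧
    ∫ x : Packet, (thresholdRule t x.obs : ℝ) ∂N.packetLaw =
      ∫ x : Packet, (h x.obs : ℝ) ∂N.packetLaw ∧
    ∫ x, N.deliveredUtility x * (h x.obs : ℝ) ∂N.packetLaw ≤
      ∫ x, N.deliveredUtility x * (thresholdRule t x.obs : ℝ) ∂N.packetLaw ∧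
    (∫ x, N.deliveredUtility x * (thresholdRule t x.obs : ℝ) ∂N.packetLaw ≤
        ∫ x, N.deliveredUtility x * (h x.obs : ℝ) ∂N.packetLaw →
      ∀ᵐ x ∂N.packetLaw, h (Packet.obs x) = thresholdRule t x.obs) := by
  have hi := N.integrable_comp_obs hh
  have of_ae : ∀ t : ℝ≥0∞, (∀ᵐ x ∂N.packetLaw, h (Packet.obs x) = thresholdRule t x.obs) →
      ∫ x : Packet, (thresholdRule t x.obs : ℝ) ∂N.packetLaw =
        ∫ x : Packet, (h x.obs : ℝ) ∂N.packetLaw ∧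
      ∫ x, N.deliveredUtility x * (h x.obs : ℝ) ∂N.packetLaw ≤
        ∫ x, N.deliveredUtility x * (thresholdRule t x.obs : ℝ) ∂N.packetLaw := by
    intro t ht
    refine ⟨integral_congr_ae ?_, (integral_congr_ae ?_).le⟩ <;>
    · filter_upwards [ht] with x hx
      rw [hx]
  set p := ∫ x : Packet, (h x.obs : ℝ) ∂N.packetLaw with hp
  -- For `p = 0` or `p = 1` the rule `h` is a.s. constant and already a threshold rule, with
  -- threshold `∞` or `0`. Only `0 < p < 1` needs a finite positive threshold.
  rcases (integral_nonneg fun x : Packet => (h x.obs).2.1 : 0 ≤ p).eq_or_lt with h0 | h0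
  · have hae : ∀ᵐ x ∂N.packetLaw, h (Packet.obs x) = thresholdRule ∞ x.obs := by
      filter_upwards [(integral_eq_zero_iff_of_nonneg (fun x : Packet => (h x.obs).2.1) hi).1
        h0.symm] with x hx
      rw [thresholdRule_top]
      exact Subtype.ext hx
    exact ⟨∞, fun _ => rfl, (of_ae _ hae).1, (of_ae _ hae).2, fun _ => hae⟩
  have hne : (∀ y, h y = 0) → False := fun hz => h0.ne' (by simp [hz])
  have hle : p ≤ 1 := by
    have := integral_mono hi (integrable_const (1 : ℝ)) fun x : Packet => (h x.obs).2.2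
    simpa using this
  rcases hle.eq_or_lt with h1 | h1
  · have hae : ∀ᵐ x ∂N.packetLaw, h (Packet.obs x) = thresholdRule 0 x.obs := by
      have hz : ∫ x : Packet, (1 - (h x.obs : ℝ)) ∂N.packetLaw = 0 := by
        rw [integral_sub (integrable_const _) hi, ← hp, h1]; simp
      filter_upwards [(integral_eq_zero_iff_of_nonneg
        (fun x : Packet => sub_nonneg.2 (h x.obs).2.2) ((integrable_const _).sub hi)).1 hz]
        with x hx
      rw [thresholdRule_zero]
      exact Subtype.ext (sub_eq_zero.1 hx).symm
    exact ⟨0, fun hz => (hne hz).elim, (of_ae _ hae).1, (of_ae _ hae).2, fun _ => hae⟩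
  · obtain ⟨t, ht, htp⟩ := N.exists_threshold_of_mem_Ioo h0 h1
    exact ⟨ENNReal.ofReal t, fun hz => (hne hz).elim, htp,
      hV.threshold_optimal hmono hh ht (htp.trans hp)⟩

end NeymanPearson

/-! ### Comparison of long-run averages. -/

section LongRun

variable {U emax : ℕ} {S : Type*} [Fintype S] [MeasurableSpace S] [DiscreteMeasurableSpace S]

/-- Fraction of the first `K` slots, in expectation, in which sensor `u` has energy `e`, the
scenario is `s` and all other sensors are idle. -/
noncomputable def Network.clearAverage (N : Network S) (μ : JointPolicy U emax S)
    (z : SysState U emax S) (u : Fin U) (e : Fin (emax + 1)) (s : S) (K : ℕ) : ℝ :=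
  (1 / (K : ℝ)) * ∑ k ∈ Finset.range K,
    (N.pathLaw μ z).real ((fun ω => ω k) ⁻¹' clearSlots u e s)

theorem Network.clearAverage_congr (N : Network S) {μ ν : JointPolicy U emax S}
    (h : ∀ u e s, N.transmitProb (μ u) e s = N.transmitProb (ν u) e s) (z : SysState U emax S)
    (u : Fin U) (e : Fin (emax + 1)) (s : S) (K : ℕ) :
    N.clearAverage μ z u e s K = N.clearAverage ν z u e s K := by
  unfold Network.clearAverage
  simp_rw [N.pathLaw_clearSlots_congr h u e s z]

theorem Network.clearAverage_nonneg (N : Network S) (μ : JointPolicy U emax S)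
    (z : SysState U emax S) (u : Fin U) (e : Fin (emax + 1)) (s : S) (K : ℕ) :
    0 ≤ N.clearAverage μ z u e s K :=
  mul_nonneg (by positivity) (Finset.sum_nonneg fun _ _ => measureReal_nonneg)

theorem Network.clearAverage_le_one (N : Network S) (μ : JointPolicy U emax S)
    (z : SysState U emax S) (u : Fin U) (e : Fin (emax + 1)) (s : S) (K : ℕ) :
    N.clearAverage μ z u e s K ≤ 1 := by
  have h : ∑ k ∈ Finset.range K, (N.pathLaw μ z).real ((fun ω => ω k) ⁻¹' clearSlots u e s) ≤ K :=
    (Finset.sum_le_sum fun _ _ => measureReal_le_one).trans (by simp)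
  rw [Network.clearAverage, one_div_mul_eq_div]
  exact div_le_one_of_le₀ h (Nat.cast_nonneg K)

theorem Network.average_reportedUtility (N : Network S)
    (hD : Integrable N.deliveredUtility N.packetLaw) (μ : JointPolicy U emax S) (u : Fin U)
    (z : SysState U emax S) (K : ℕ) :
    (1 / (K : ℝ)) * ∫ ω, ∑ k ∈ Finset.range K, N.reportedUtility u (ω k) ∂(N.pathLaw μ z) =
      ∑ e, ∑ s, N.transmitGain (μ u) e s * N.clearAverage μ z u e s K := by
  rw [integral_finsetSum _ fun k _ => N.integrable_pathLaw_reportedUtility hD μ u z k]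
  simp_rw [N.integral_pathLaw_reportedUtility hD, Network.clearAverage]
  rw [Finset.sum_comm, Finset.mul_sum]
  refine Finset.sum_congr rfl fun e _ => ?_
  rw [Finset.sum_comm, Finset.mul_sum]
  refine Finset.sum_congr rfl fun s _ => ?_
  rw [← Finset.mul_sum]
  ring

/-- The bound is uniform in `K`; it supplies the boundedness that comparing real liminfs requires.
-/
theorem Network.abs_average_le (N : Network S) (μ : JointPolicy U emax S)
    (u : Fin U) (z : SysState U emax S) (K : ℕ) :
    |∑ e, ∑ s, N.transmitGain (μ u) e s * N.clearAverage μ z u e s K| ≤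
      ∑ e, ∑ s, |N.transmitGain (μ u) e s| := by
  refine (Finset.abs_sum_le_sum_abs _ _).trans (Finset.sum_le_sum fun e _ => ?_)
  refine (Finset.abs_sum_le_sum_abs _ _).trans (Finset.sum_le_sum fun s _ => ?_)
  rw [abs_mul, abs_of_nonneg (N.clearAverage_nonneg μ z u e s K)]
  exact mul_le_of_le_one_right (abs_nonneg _) (N.clearAverage_le_one μ z u e s K)

theorem Network.sensorUtility_eq (N : Network S)
    (hD : Integrable N.deliveredUtility N.packetLaw) (μ : JointPolicy U emax S) (u : Fin U)
    (z : SysState U emax S) : N.sensorUtility μ u z =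
      liminf (fun K => ∑ e, ∑ s, N.transmitGain (μ u) e s * N.clearAverage μ z u e s K) atTop := by
  unfold Network.sensorUtility
  simp_rw [N.average_reportedUtility hD]

theorem Network.isBoundedUnder_average (N : Network S) (μ : JointPolicy U emax S) (u : Fin U)
    (z : SysState U emax S) : IsBoundedUnder (· ≥ ·) atTop
      (fun K => ∑ e, ∑ s, N.transmitGain (μ u) e s * N.clearAverage μ z u e s K) :=
  isBoundedUnder_of ⟨_, fun K => (abs_le.1 (N.abs_average_le μ u z K)).1⟩

theorem Network.isCoboundedUnder_average (N : Network S) (μ : JointPolicy U emax S) (u : Fin U)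
    (z : SysState U emax S) : IsCoboundedUnder (· ≥ ·) atTop
      (fun K => ∑ e, ∑ s, N.transmitGain (μ u) e s * N.clearAverage μ z u e s K) :=
  (isBoundedUnder_of ⟨_, fun K => (abs_le.1 (N.abs_average_le μ u z K)).2⟩ :
    IsBoundedUnder (· ≤ ·) atTop _).isCoboundedUnder_flip

variable {N : Network S} {μ ν : JointPolicy U emax S}

theorem Network.sensorUtility_mono (hD : Integrable N.deliveredUtility N.packetLaw)
    (h : ∀ u e s, N.transmitProb (μ u) e s = N.transmitProb (ν u) e s)
    (hg : ∀ u e s, N.transmitGain (μ u) e s ≤ N.transmitGain (ν u) e s) (u : Fin U)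
    (z : SysState U emax S) : N.sensorUtility μ u z ≤ N.sensorUtility ν u z := by
  rw [N.sensorUtility_eq hD, N.sensorUtility_eq hD]
  refine liminf_le_liminf (Eventually.of_forall fun K => ?_) (N.isBoundedUnder_average μ u z)
    (N.isCoboundedUnder_average ν u z)
  refine Finset.sum_le_sum fun e _ => Finset.sum_le_sum fun s _ => ?_
  rw [N.clearAverage_congr h]
  exact mul_le_mul_of_nonneg_right (hg u e s) (N.clearAverage_nonneg ν z u e s K)

/-- For large `K` the clear average at `(e, s)` exceeds some `c > 0`, so the average utility under
`ν` exceeds that under `μ` by at least `c` times the gap between the gains at `(e, s)`. This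
constant survives the liminf. -/
theorem Network.sensorUtility_lt (hD : Integrable N.deliveredUtility N.packetLaw)
    (h : ∀ u e s, N.transmitProb (μ u) e s = N.transmitProb (ν u) e s)
    (hg : ∀ u e s, N.transmitGain (μ u) e s ≤ N.transmitGain (ν u) e s) {u : Fin U}
    {z : SysState U emax S} {e : Fin (emax + 1)} {s : S} (hc : 0 < N.clearFrequency μ z u e s)
    (hlt : N.transmitGain (μ u) e s < N.transmitGain (ν u) e s) :
    N.sensorUtility μ u z < N.sensorUtility ν u z := by
  rw [N.sensorUtility_eq hD, N.sensorUtility_eq hD]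
  obtain ⟨c, hc0, hc1⟩ := exists_between hc
  have hev : ∀ᶠ K in atTop, c < N.clearAverage μ z u e s K :=
    eventually_lt_of_lt_liminf hc1
      (isBoundedUnder_of ⟨0, fun K => N.clearAverage_nonneg μ z u e s K⟩)
  have hd : 0 < (N.transmitGain (ν u) e s - N.transmitGain (μ u) e s) * c :=
    mul_pos (sub_pos.2 hlt) hc0
  refine (lt_add_of_pos_right _ hd).trans_le ?_
  rw [← liminf_add_const _ _ _ (N.isCoboundedUnder_average μ u z)
    (N.isBoundedUnder_average μ u z)]
  refine liminf_le_liminf ?_ ?_ (N.isCoboundedUnder_average ν u z)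
  · filter_upwards [hev] with K hK
    rw [← le_sub_iff_add_le', ← Finset.sum_sub_distrib]
    -- With common clear averages, the difference is a double sum of nonnegative terms, bounded
    -- below by its term at `(e, s)`.
    simp_rw [← Finset.sum_sub_distrib, ← N.clearAverage_congr h, ← sub_mul]
    have hnn : ∀ e s, 0 ≤ (N.transmitGain (ν u) e s - N.transmitGain (μ u) e s) *
        N.clearAverage μ z u e s K := fun e s =>
      mul_nonneg (sub_nonneg.2 (hg u e s)) (N.clearAverage_nonneg μ z u e s K)
    calc _ ≤ (N.transmitGain (ν u) e s - N.transmitGain (μ u) e s) *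
          N.clearAverage μ z u e s K := mul_le_mul_of_nonneg_left hK.le (sub_pos.2 hlt).le
      _ ≤ ∑ s, (N.transmitGain (ν u) e s - N.transmitGain (μ u) e s) *
          N.clearAverage μ z u e s K :=
        Finset.single_le_sum (fun s _ => hnn e s) (Finset.mem_univ s)
      _ ≤ _ := Finset.single_le_sum (f := fun e => ∑ s, (N.transmitGain (ν u) e s -
          N.transmitGain (μ u) e s) * N.clearAverage μ z u e s K)
          (fun e _ => Finset.sum_nonneg fun s _ => hnn e s) (Finset.mem_univ e)
  · exact isBoundedUnder_of ⟨_, fun K =>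
      add_le_add_left (abs_le.1 (N.abs_average_le μ u z K)).1 _⟩

end LongRun

/-! ### Construction of the threshold policy and conclusion. -/

theorem proposition1 {U emax : ℕ} {S : Type*} [Fintype S] [MeasurableSpace S]
    [DiscreteMeasurableSpace S] (N : Network S) (Vbar : ℝ → ℝ)
    (hVbar : N.IsExpectedUtility Vbar) (hreg : IsRegularUtility Vbar)
    (μ : JointPolicy U emax S) :
    ∃ (yth : Fin U → Fin (emax + 1) → S → ℝ≥0∞) (μth : JointPolicy U emax S),
      JointPolicy.IsThreshold μth yth ∧
      (∀ u e s, N.transmitProb (μth u) e s = N.transmitProb (μ u) e s) ∧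
      (∀ z : SysState U emax S, N.networkUtility μ z ≤ N.networkUtility μth z) ∧
      (∀ z : SysState U emax S, N.IsOptimal μ z →
        N.IsOptimal μth z ∧
        ∀ u e s, 0 < N.clearFrequency μ z u e s →
          ∀ᵐ x ∂N.packetLaw, (μ u).prob e x.obs s = thresholdRule (yth u e s) x.obs) := by
  choose yth htop hprob hgain hunique using fun u e s =>
    hVbar.exists_threshold hreg.strictMonoOn ((μ u).measurable_prob e s)
  let μth : JointPolicy U emax S := fun u =>
    { prob := fun e y s => thresholdRule (yth u e s) y
      measurable_prob := fun e s => measurable_thresholdRule _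
      prob_empty := fun y s => by
        -- At zero energy the given rule vanishes identically, so the chosen threshold is `∞` and
        -- the new policy is admissible.
        rw [htop u 0 s fun y => (μ u).prob_empty y s, thresholdRule_top] }
  have hp : ∀ u e s, N.transmitProb (μ u) e s = N.transmitProb (μth u) e s := fun u e s =>
    (hprob u e s).symm
  have hg : ∀ u e s, N.transmitGain (μ u) e s ≤ N.transmitGain (μth u) e s := hgain
  have hmono := Network.sensorUtility_mono hVbar.1 hp hg
  have hle : ∀ z, N.networkUtility μ z ≤ N.networkUtility μth z := fun z =>
    Finset.sum_le_sum fun u _ => hmono u z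
  refine ⟨yth, μth, fun _ _ _ _ _ => rfl, hprob, hle, fun z hopt =>
    ⟨fun ν => (hopt ν).trans (hle z), fun u e s hc => hunique u e s ?_⟩⟩
  -- A strict gain at `(e, s)` would raise the utility of sensor `u` while no other sensor loses, so
  -- `μth` would beat the optimal `μ`.
  by_contra! hlt
  exact (Finset.sum_lt_sum (fun i _ => hmono i z) ⟨u, Finset.mem_univ u,
    Network.sensorUtility_lt hVbar.1 hp hg hc hlt⟩).not_ge (hopt μth)
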